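/- Consider a differential game with $M$ players in which player $i$ chooses $\omega_i\in\mathbb R^{n_i}$, with joint strategies $\omega=(\omega_1,\dots,\omega_M)=(x_1,\dots,x_n)\in\mathbb R^n$, $n=\sum_{i=1}^M n_i$, and utilities $u=(u_1,\dots,u_M)$, $u_i:\mathbb R^n\to\mathbb R$. Let $Du=(\nabla_{\omega_1}u_1,\dots,\nabla_{\omega_M}u_M)$ be the simultaneous gradient. All spaces below are defined with weak derivatives. Let $C_0$ be the closure of the smooth functions of finite norm in $H^2(\mathbb R^n)$, and let $C_0^M=\{u : u_i\in C_0\cap C^\infty(\mathbb R^n)\ \text{for all } i\}$. Let $C_1$ be the Hilbert space of vector fields $X=(f_1,\dots,f_n)$ with all $f_i\in H^1(\mathbb R^n)$, with the inner product $$\langle X,Y\rangle_1=\sum_{i=1}^n\int_{\mathbb R^n} f_i g_i\,dx+\sum_{i=1}^n\sum_{j=1}^n\int_{\mathbb R^n}\frac{\partial f_i}{\partial x_j}\frac{\partial g_i}{\partial x_j}\,dx ,\qquad Y=(g_1,\dots,g_n),$$ and let $d_2$ be the operator on $C_1$ given by $(d_2X)_{ij}=-\frac{\partial f_i}{\partial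 x_j}+\frac{\partial f_j}{\partial x_i}\in L^2(\mathbb R^n)$ for $i<j$ and $(d_2X)_{ij}=0$ for $i\ge j$. Put $$\mathcal V=\{u\in C_0^M : Du\ne 0,\ Du\in\ker(d_2)^{\perp}\}\cup\{0\},\qquad \mathcal N=\{u\in C_0^M : Du=0\},$$ where $\perp$ is taken in $C_1$. The game is called near vector potential if $u\in\mathcal V\oplus\mathcal N$, that is, $u=v+w$ with $v\in\mathcal V$ and $w\in\mathcal N$. Theorem. Suppose that the game is near vector potential and that $u$ is compactly supported on a compact set $\Omega\subset\mathbb R^n$, i.e. $\operatorname{supp}u_i\subseteq\Omega$ for every $i$. Then the system $\dot x=Du(x)$ is Poincaré recurrent: for every $x_0\in\mathbb R^n$ there is a unique trajectory $x:\mathbb R\to\mathbb R^n$ with $x(0)=x_0$, and for (Lebesgue-)almost every initialization $x(0)\in\Omega$ the trajectory returns arbitrarily close to $x(0)$ infinitely often, i.e. for every $\varepsilon>0$ there are arbitrarily large times $t$ with $|x(t)-x(0)|<\varepsilon$. -/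

import Mathlib

open MeasureTheory Filter Set
open scoped ContDiff Topology

noncomputable section

namespace DiffGame

/-- The Euclidean space `ℝⁿ`. -/
abbrev E (n : ℕ) : Type := EuclideanSpace ℝ (Fin n)

section Sobolev

variable {n : ℕ}

/-- The classical partial derivative `∂f/∂xᵢ`. -/
def pderiv (i : Fin n) (f : E n → ℝ) : E n → ℝ :=
  fun x => fderiv ℝ f x (EuclideanSpace.single i 1)

/-- The iterated classical partial derivative along a word of directions:
`iterPderiv [i, j] f = ∂²f/∂xᵢ∂xⱼ`. Every multi-index `α` is given by a word of length `|α|`. -/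
def iterPderiv (s : List (Fin n)) (f : E n → ℝ) : E n → ℝ :=
  s.foldr pderiv f

/-- `g` is a weak partial derivative of `f` of the order given by the word `s`. -/
def IsWeakDeriv (s : List (Fin n)) (f g : E n → ℝ) : Prop :=
  LocallyIntegrable f volume ∧ LocallyIntegrable g volume ∧
    ∀ φ : E n → ℝ, ContDiff ℝ ∞ φ → HasCompactSupport φ →
      ∫ x, f x * iterPderiv s φ x = (-1) ^ s.length * ∫ x, g x * φ x

open Classical in
/-- A representative of the weak derivative of `f` (unique almost everywhere when it exists;
the value is `0` when there is none). -/
def weakDeriv (s : List (Fin n)) (f : E n → ℝ) : E n → ℝ :=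
  if h : ∃ g, IsWeakDeriv s f g then h.choose else 0

/-- Membership in the Sobolev space `Hᵏ(ℝⁿ)`: all weak derivatives of order at most `k` exist and
are in `L²(ℝⁿ)`. The empty word says that `f` itself is in `L²(ℝⁿ)`. -/
def MemH (k : ℕ) (f : E n → ℝ) : Prop :=
  ∀ s : List (Fin n), s.length ≤ k → ∃ g, IsWeakDeriv s f g ∧ MemLp g 2 volume

/-- The inner product `⟨f, g⟩₀` of `H²(ℝⁿ)`. -/
def inner0 (f g : E n → ℝ) : ℝ :=
  (∫ x, f x * g x) + (∑ i, ∫ x, weakDeriv [i] f x * weakDeriv [i] g x) +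
    ∑ i, ∑ j, ∫ x, weakDeriv [i, j] f x * weakDeriv [i, j] g x

/-- The norm `‖f‖₀`. -/
def norm0 (f : E n → ℝ) : ℝ := Real.sqrt (inner0 f f)

/-- `C₀`: the closure in `H²(ℝⁿ)` of the smooth functions (of finite norm). -/
def C0 (n : ℕ) : Set (E n → ℝ) :=
  {f | MemH 2 f ∧ ∀ ε > 0, ∃ g : E n → ℝ, ContDiff ℝ ∞ g ∧ MemH 2 g ∧ norm0 (f - g) < ε}

/-- `C₁`: the vector fields on `ℝⁿ` all of whose components are in `H¹(ℝⁿ)`. -/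
def C1 (n : ℕ) : Set (E n → E n) :=
  {X | ∀ i, MemH 1 (fun x => X x i)}

/-- The inner product `⟨X, Y⟩₁` of `C₁`. -/
def inner1 (X Y : E n → E n) : ℝ :=
  (∑ i, ∫ x, X x i * Y x i) +
    ∑ i, ∑ j, ∫ x, weakDeriv [j] (fun y => X y i) x * weakDeriv [j] (fun y => Y y i) x

/-- The operator `d₂`: `(d₂ X)ᵢⱼ = -∂Xᵢ/∂xⱼ + ∂Xⱼ/∂xᵢ` for `i < j`, and `0` otherwise. -/
def d2 (X : E n → E n) (i j : Fin n) : E n → ℝ :=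
  fun x => if i < j then
    -weakDeriv [j] (fun y => X y i) x + weakDeriv [i] (fun y => X y j) x else 0

/-- The kernel of `d₂ : C₁ → C₂`, where `C₂` consists of matrices of `L²` functions, so that
vanishing means vanishing almost everywhere. -/
def kerD2 (n : ℕ) : Set (E n → E n) :=
  {X | X ∈ C1 n ∧ ∀ i j, d2 X i j =ᵐ[volume] 0}

/-- The orthogonal complement of `ker d₂` in `C₁`. -/
def kerD2Perp (n : ℕ) : Set (E n → E n) :=
  {X | X ∈ C1 n ∧ ∀ Y ∈ kerD2 n, inner1 Y X = 0}

end Sobolev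

section Games

variable {M : ℕ}

/-- The joint strategy space `ℝⁿ`, `n = ∑ᵢ dᵢ`, of `M` players where player `i` plays a strategy
in `ℝ^{dᵢ}`; a joint strategy is the concatenation of the blocks `ω₁, …, ω_M`. -/
abbrev Joint (d : Fin M → ℕ) : Type := E (∑ i, d i)

/-- The player to whose block the coordinate `j` of the joint strategy belongs. -/
def owner (d : Fin M → ℕ) (j : Fin (∑ i, d i)) : Fin M := (finSigmaFinEquiv.symm j).1

/-- The simultaneous gradient `Du = (∇_{ω₁} u₁, …, ∇_{ω_M} u_M)`. -/
def simGrad (d : Fin M → ℕ) (u : Fin M → Joint d → ℝ) : Joint d → Joint d :=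
  fun x => WithLp.toLp 2 (fun j => pderiv j (u (owner d j)) x)

/-- `C₀ᴹ`: tuples of utilities in `C₀ ∩ C^∞(ℝⁿ)`. -/
def C0M (d : Fin M → ℕ) : Set (Fin M → Joint d → ℝ) :=
  {u | ∀ i, u i ∈ C0 (∑ i, d i) ∧ ContDiff ℝ ∞ (u i)}

/-- The class `𝒱`. -/
def classV (d : Fin M → ℕ) : Set (Fin M → Joint d → ℝ) :=
  {u | u ∈ C0M d ∧ simGrad d u ≠ 0 ∧ simGrad d u ∈ kerD2Perp (∑ i, d i)} ∪ {0}

/-- The class `𝒩` of non-strategic games. -/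
def classN (d : Fin M → ℕ) : Set (Fin M → Joint d → ℝ) :=
  {u | u ∈ C0M d ∧ simGrad d u = 0}

/-- Near vector potential games: `u = v + w` with `v ∈ 𝒱` and `w ∈ 𝒩`. -/
def IsNearVectorPotential (d : Fin M → ℕ) (u : Fin M → Joint d → ℝ) : Prop :=
  ∃ v ∈ classV d, ∃ w ∈ classN d, u = v + w

end Games

/-- `x : ℝ → ℝⁿ` is the trajectory of `ẋ = X(x)` with `x(0) = x₀`. -/
def IsTrajectory {n : ℕ} (X : E n → E n) (x₀ : E n) (x : ℝ → E n) : Prop :=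
  x 0 = x₀ ∧ ∀ t, HasDerivAt x (X (x t)) t

/-- The system `ẋ = X(x)` is Poincaré recurrent on `Ω`: its trajectories exist for all times and
are unique, and for almost every `x₀ ∈ Ω` the trajectory from `x₀` enters each neighbourhood of
`x₀` at arbitrarily large times. -/
def IsPoincareRecurrentOn {n : ℕ} (X : E n → E n) (Ω : Set (E n)) : Prop :=
  (∀ x₀, ∃! x : ℝ → E n, IsTrajectory X x₀ x) ∧
    ∀ᵐ x₀ ∂(volume.restrict Ω), ∀ x : ℝ → E n, IsTrajectory X x₀ x →
      ∀ ε > 0, ∃ᶠ t in atTop, dist (x t) x₀ < ε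

end DiffGame

end

/-! Adding `w` does not change the simultaneous gradient, so the field is X = Dv, smooth and, thanks
to the support of u, compactly supported. Then div X is a test function, and its gradient lies in
ker d₂ because mixed partials commute. Integration by parts turns the `inner1` pairing of grad f
with X into minus the H¹ pairing of f with div X. Taking f = div X, orthogonality makes the H¹ norm
of div X vanish, so X is divergence free (`divergence_eq_zero_of_mem_kerD2Perp`).

The rest is Liouville plus Poincaré. The flow φ is never differentiated in space: it is Lipschitz by
Grönwall, and invariance of the measure is tested on Lipschitz functions, using Rademacher's
theorem. Restricting to {X ≠ 0} gives a finite measure, so the time-one map is conservative; zeros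
of X are fixed points. -/

namespace DiffGame

/-! ### Global flows of bounded Lipschitz fields -/

section Flow

open scoped NNReal

variable {V : Type*} [NormedAddCommGroup V] [NormedSpace ℝ V]

/-- Two integral curves of a Lipschitz vector field on symmetric intervals around `0` with the same
initial value agree on the smaller interval. -/
theorem integralCurve_eq_of_abs_lt {X : V → V} {K : ℝ≥0} (hX : LipschitzWith K X) {a b t : ℝ}
    {α β : ℝ → V} (hα : ∀ s, |s| < a → HasDerivAt α (X (α s)) s)
    (hβ : ∀ s, |s| < b → HasDerivAt β (X (β s)) s) (h0 : α 0 = β 0) (ha : |t| < a) (hb : |t| < b) :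
    α t = β t := by
  have key := ODE_solution_unique_of_mem_Ioo (v := fun _ => X) (s := fun _ => univ) (K := K)
    (f := α) (g := β) (t₀ := 0) (a := -min a b) (b := min a b)
    (fun _ _ => hX.lipschitzOnWith) (by
      have : 0 < min a b := lt_min ((abs_nonneg t).trans_lt ha) ((abs_nonneg t).trans_lt hb)
      constructor <;> linarith)
    (fun s hs => ⟨hα s ((abs_lt.2 hs).trans_le (min_le_left _ _)), mem_univ _⟩)
    (fun s hs => ⟨hβ s ((abs_lt.2 hs).trans_le (min_le_right _ _)), mem_univ _⟩) h0
  exact key (abs_lt.1 (lt_min ha hb))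

/-- A bounded Lipschitz vector field has integral curves on arbitrarily large intervals. -/
theorem exists_integralCurve_Ioo [CompleteSpace V] {X : V → V} {K L : ℝ≥0}
    (hX : LipschitzWith K X) (hb : ∀ x, ‖X x‖ ≤ L) (x₀ : V) (T : ℝ≥0) :
    ∃ α : ℝ → V, α 0 = x₀ ∧ ∀ t, |t| < (T : ℝ) → HasDerivAt α (X (α t)) t := by
  have hT : (0 : ℝ) ≤ T := T.2
  -- At speed at most `L`, a curve moves at most `L * T` in time `T`, so a ball of that radius
  -- allows the whole interval.
  have hP : IsPicardLindelof (fun _ => X) (tmin := -(T : ℝ)) (tmax := T) ⟨0, by simp⟩ x₀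
      (L * T) 0 L K :=
    { lipschitzOnWith := fun _ _ => hX.lipschitzOnWith
      continuousOn := fun _ _ => continuousOn_const
      norm_le := fun _ _ x _ => hb x
      mul_max_le := by simp }
  obtain ⟨α, h0, hα⟩ := hP.exists_eq_forall_mem_Icc_hasDerivWithinAt₀
  refine ⟨α, h0, fun t ht => ?_⟩
  have ht' := abs_lt.1 ht
  exact (hα t ⟨ht'.1.le, ht'.2.le⟩).hasDerivAt (Icc_mem_nhds ht'.1 ht'.2)

/-- A bounded Lipschitz vector field is complete. -/
theorem exists_integralCurve [CompleteSpace V] {X : V → V} {K L : ℝ≥0}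
    (hX : LipschitzWith K X) (hb : ∀ x, ‖X x‖ ≤ L) (x₀ : V) :
    ∃ α : ℝ → V, α 0 = x₀ ∧ ∀ t, HasDerivAt α (X (α t)) t := by
  choose α h0 hα using fun n : ℕ => exists_integralCurve_Ioo hX hb x₀ (n + 1)
  have hlt : ∀ t : ℝ, |t| < ((⌊|t|⌋₊ + 1 : ℝ≥0) : ℝ) := fun t => by
    push_cast
    exact Nat.lt_floor_add_one _
  -- The curves are glued diagonally: the one of index `⌊|t|⌋₊` lives beyond `|t|`, and by
  -- uniqueness agrees near `t` with the glued curve.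
  refine ⟨fun t => α ⌊|t|⌋₊ t, by simp [h0], fun t => ?_⟩
  refine (hα _ t (hlt t)).congr_of_eventuallyEq ?_
  have : ∀ᶠ s in 𝓝 t, |s| < ((⌊|t|⌋₊ + 1 : ℝ≥0) : ℝ) :=
    continuous_abs.continuousAt.eventually_lt continuousAt_const (hlt t)
  filter_upwards [this] with s hs
  exact integralCurve_eq_of_abs_lt hX (hα _) (hα _) ((h0 _).trans (h0 _).symm) (hlt s) hs

/-- `φ` is the global flow of the autonomous vector field `X`. -/
structure IsGlobalFlow (X : V → V) (φ : ℝ → V → V) : Prop where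
  zero : ∀ x, φ 0 x = x
  deriv : ∀ x t, HasDerivAt (fun s => φ s x) (X (φ t x)) t

theorem exists_isGlobalFlow [CompleteSpace V] {X : V → V} {K L : ℝ≥0}
    (hX : LipschitzWith K X) (hb : ∀ x, ‖X x‖ ≤ L) : ∃ φ, IsGlobalFlow X φ := by
  choose α h0 hα using exists_integralCurve hX hb
  exact ⟨fun t x => α x t, h0, hα⟩

namespace IsGlobalFlow

variable {X : V → V} {φ : ℝ → V → V} {K L : ℝ≥0}

theorem eq_of_hasDerivAt (h : IsGlobalFlow X φ) (hX : LipschitzWith K X) {α : ℝ → V}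
    (hα : ∀ t, HasDerivAt α (X (α t)) t) : α = fun t => φ t (α 0) :=
  ODE_solution_unique_univ (v := fun _ => X) (s := fun _ => univ) (t₀ := 0)
    (fun _ => hX.lipschitzOnWith) (fun t => ⟨hα t, mem_univ _⟩)
    (fun t => ⟨h.deriv _ t, mem_univ _⟩) (h.zero _).symm

theorem add_apply (h : IsGlobalFlow X φ) (hX : LipschitzWith K X) (t s : ℝ) (x : V) :
    φ (t + s) x = φ t (φ s x) := by
  have := h.eq_of_hasDerivAt hX (α := fun r => φ (r + s) x)
    (fun r => (h.deriv x (r + s)).comp_add_const r s)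
  simpa using congrFun this t

theorem apply_of_eq_zero (h : IsGlobalFlow X φ) (hX : LipschitzWith K X) {x : V} (hx : X x = 0)
    (t : ℝ) : φ t x = x := by
  have := h.eq_of_hasDerivAt hX (α := fun _ => x) (fun r => by simpa [hx] using hasDerivAt_const r x)
  exact (congrFun this t).symm

theorem iterate_one (h : IsGlobalFlow X φ) (hX : LipschitzWith K X) (n : ℕ) (x : V) :
    (φ 1)^[n] x = φ n x := by
  induction n with
  | zero => simp [h.zero]
  | succ n ih =>
    rw [Function.iterate_succ_apply', ih, ← h.add_apply hX]
    push_cast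
    rw [add_comm]

/-- Grönwall's inequality. This is the only spatial regularity of the flow that Liouville's theorem
will need. -/
theorem lipschitzWith_apply (h : IsGlobalFlow X φ) (hX : LipschitzWith K X) {t : ℝ} (ht : 0 ≤ t) :
    LipschitzWith (Real.exp (K * t)).toNNReal (φ t) := by
  refine LipschitzWith.of_dist_le_mul fun x y => ?_
  rw [Real.coe_toNNReal _ (Real.exp_pos _).le, mul_comm]
  have := dist_le_of_trajectories_ODE (v := fun _ => X) (K := K) (a := 0) (b := t)
    (f := fun s => φ s x) (g := fun s => φ s y) (δ := dist x y) (fun _ => hX)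
    (HasDerivAt.continuousOn fun s _ => h.deriv x s) (fun s _ => (h.deriv x s).hasDerivWithinAt)
    (HasDerivAt.continuousOn fun s _ => h.deriv y s) (fun s _ => (h.deriv y s).hasDerivWithinAt)
    (by simp [h.zero]) t ⟨ht, le_rfl⟩
  simpa using this

theorem lipschitzWith_time (h : IsGlobalFlow X φ) (hb : ∀ x, ‖X x‖ ≤ L) (x : V) :
    LipschitzWith L (fun t => φ t x) :=
  lipschitzWith_of_nnnorm_deriv_le (fun t => (h.deriv x t).differentiableAt) fun t => by
    rw [(h.deriv x t).deriv]
    exact hb _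

theorem neg (h : IsGlobalFlow X φ) : IsGlobalFlow (fun x => -X x) (fun t => φ (-t)) where
  zero x := by simp [h.zero]
  deriv x t := by
    simpa [Function.comp_def] using (h.deriv x (-t)).scomp t (hasDerivAt_neg t)

theorem continuous_apply (h : IsGlobalFlow X φ) (hX : LipschitzWith K X) (t : ℝ) :
    Continuous (φ t) := by
  rcases le_total 0 t with ht | ht
  · exact (h.lipschitzWith_apply hX ht).continuous
  · simpa using (h.neg.lipschitzWith_apply hX.neg (neg_nonneg.2 ht)).continuous

end IsGlobalFlow

end Flow

end DiffGame

namespace DiffGame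

/-! ### Liouville's theorem and Poincaré recurrence -/

section Liouville

open scoped NNReal

variable {n : ℕ}

/-- The divergence of a vector field on `ℝⁿ`. -/
noncomputable def divergence (X : E n → E n) (x : E n) : ℝ :=
  ∑ i, pderiv i (fun y => X y i) x

theorem fderiv_apply_eq_sum {F : E n → ℝ} {x : E n} (hF : DifferentiableAt ℝ F x) (v : E n) :
    fderiv ℝ F x v = ∑ i, lineDeriv ℝ F x (EuclideanSpace.single i 1) * v i := by
  have hv : v = ∑ i, v i • EuclideanSpace.single i (1 : ℝ) := by
    simpa using ((EuclideanSpace.basisFun (Fin n) ℝ).sum_repr v).symm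
  conv_lhs => rw [hv]
  simp_rw [map_sum, map_smul, hF.lineDeriv_eq_fderiv, smul_eq_mul, mul_comm]

variable {X : E n → E n}

theorem contDiff_coord (hX : ContDiff ℝ 1 X) (i : Fin n) : ContDiff ℝ 1 (fun x => X x i) :=
  contDiff_euclidean.1 hX i

theorem hasCompactSupport_coord (hc : HasCompactSupport X) (i : Fin n) :
    HasCompactSupport (fun x => X x i) :=
  hc.comp_left (g := fun v : E n => v i) rfl

theorem integrable_lineDeriv_mul_coord (hX : ContDiff ℝ 1 X) (hc : HasCompactSupport X)
    {F : E n → ℝ} {C : ℝ≥0} (hF : LipschitzWith C F) (i : Fin n) :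
    Integrable (fun x => lineDeriv ℝ F x (EuclideanSpace.single i 1) * X x i) :=
  ((contDiff_coord hX i).continuous.integrable_of_hasCompactSupport
    (hasCompactSupport_coord hc i)).bdd_mul
    (measurable_lineDeriv hF.continuous).aestronglyMeasurable
    (Eventually.of_forall fun _ => norm_lineDeriv_le_of_lipschitz ℝ hF)

/-- The derivative of a Lipschitz function along a divergence free vector field with compact
support has zero integral. -/
theorem integral_sum_lineDeriv_mul_eq_zero (hX : ContDiff ℝ 1 X) (hc : HasCompactSupport X)
    (hdiv : ∀ x, divergence X x = 0) {F : E n → ℝ} {C : ℝ≥0} (hF : LipschitzWith C F) :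
    ∫ x, ∑ i, lineDeriv ℝ F x (EuclideanSpace.single i 1) * X x i = 0 := by
  rw [integral_finsetSum _ fun i _ => integrable_lineDeriv_mul_coord hX hc hF i]
  have key : ∀ i : Fin n, ∫ x, lineDeriv ℝ F x (EuclideanSpace.single i 1) * X x i =
      ∫ x, -(pderiv i (fun y => X y i) x) * F x := fun i => by
    obtain ⟨D, hD⟩ := (contDiff_coord hX i).lipschitzWith_of_hasCompactSupport
      (hasCompactSupport_coord hc i) one_ne_zero
    rw [hF.integral_lineDeriv_mul_eq hD (hasCompactSupport_coord hc i)]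
    congr 1 with x
    rw [((contDiff_coord hX i).differentiable one_ne_zero x).lineDeriv_eq_fderiv, map_neg]
    rfl
  have hint : ∀ i : Fin n, Integrable (fun x => -(pderiv i (fun y => X y i) x) * F x) := fun i => by
    have hcont : Continuous (pderiv i (fun y => X y i)) :=
      ((contDiff_coord hX i).continuous_fderiv one_ne_zero).clm_apply continuous_const
    refine (hcont.neg.mul hF.continuous).integrable_of_hasCompactSupport ?_
    exact ((hasCompactSupport_coord hc i).fderiv_apply ℝ _).neg.mul_right
  simp_rw [key]
  rw [← integral_finsetSum _ fun i _ => hint i]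
  simp_rw [← Finset.sum_mul, Finset.sum_neg_distrib]
  have h0 : ∀ x, ∑ i, pderiv i (fun y => X y i) x = 0 := hdiv
  simp [h0]

namespace IsGlobalFlow

variable {φ : ℝ → E n → E n} {K L : ℝ≥0}

theorem apply_eq_of_notMem (h : IsGlobalFlow X φ) (hK : LipschitzWith K X) {x : E n}
    (hx : x ∉ tsupport X) (t : ℝ) : φ t x = x :=
  h.apply_of_eq_zero hK (image_eq_zero_of_notMem_tsupport hx) t

/-- `F` itself need not be integrable; subtracting it leaves a function supported where the flow
moves points. -/
theorem integrable_comp_sub (h : IsGlobalFlow X φ) (hK : LipschitzWith K X)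
    (hc : HasCompactSupport X) {F : E n → ℝ} (hF : Continuous F) (t : ℝ) :
    Integrable (fun x => F (φ t x) - F x) := by
  refine ((hF.comp (h.continuous_apply hK t)).sub hF).integrable_of_hasCompactSupport ?_
  exact HasCompactSupport.intro hc fun x hx => by simp [h.apply_eq_of_notMem hK hx]

/-- Differentiation under the integral: the integrand is `C * L`-Lipschitz in time on `tsupport X`
and constant off it, and Rademacher gives the chain rule almost everywhere at time 0. -/
theorem hasDerivAt_integral_comp_sub (h : IsGlobalFlow X φ) (hK : LipschitzWith K X)
    (hL : ∀ x, ‖X x‖ ≤ L) (hX : ContDiff ℝ 1 X) (hc : HasCompactSupport X)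
    (hdiv : ∀ x, divergence X x = 0) {F : E n → ℝ} {C : ℝ≥0} (hF : LipschitzWith C F) :
    HasDerivAt (fun s => ∫ x, (F (φ s x) - F x)) 0 0 := by
  refine (hasDerivAt_integral_of_dominated_loc_of_lip (s := univ) univ_mem
    (bound := (tsupport X).indicator fun _ => (C * L : ℝ))
    (Eventually.of_forall fun s => (h.integrable_comp_sub hK hc hF.continuous s).1)
    (h.integrable_comp_sub hK hc hF.continuous 0)
    (integrable_finsetSum _ fun i _ => integrable_lineDeriv_mul_coord hX hc hF i).1
    (Eventually.of_forall fun x => ?_) ?_ ?_).2.congr_deriv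
      (integral_sum_lineDeriv_mul_eq_zero hX hc hdiv hF)
  · by_cases hx : x ∈ tsupport X
    · have h1 : Real.nnabs ((tsupport X).indicator (fun _ => (C * L : ℝ)) x) = C * L := by
        rw [indicator_of_mem hx]
        ext
        simp
      rw [h1, lipschitzOnWith_univ]
      refine LipschitzWith.of_dist_le_mul fun s s' => ?_
      rw [dist_sub_right]
      exact (hF.comp (h.lipschitzWith_time hL x)).dist_le_mul s s'
    · simp only [h.apply_eq_of_notMem hK hx]
      exact ((LipschitzWith.const (F x - F x)).weaken zero_le).lipschitzOnWith
  · exact (integrable_indicator_iff (isClosed_tsupport X).measurableSet).2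
      (integrableOn_const hc.isCompact.measure_lt_top.ne)
  · filter_upwards [hF.ae_differentiableAt (μ := volume)] with x hx
    rw [← fderiv_apply_eq_sum hx]
    have h2 : HasFDerivAt F (fderiv ℝ F x) (φ 0 x) := by
      rw [h.zero]
      exact hx.hasFDerivAt
    have h3 := h.deriv x 0
    have h4 := (h2.comp_hasDerivAt 0 h3).sub_const (F x)
    rwa [h.zero] at h4

theorem integral_comp_sub_eq_zero (h : IsGlobalFlow X φ) (hK : LipschitzWith K X)
    (hL : ∀ x, ‖X x‖ ≤ L) (hX : ContDiff ℝ 1 X) (hc : HasCompactSupport X)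
    (hdiv : ∀ x, divergence X x = 0) {F : E n → ℝ} {C : ℝ≥0} (hF : LipschitzWith C F)
    {t : ℝ} (ht : 0 ≤ t) : ∫ x, (F (φ t x) - F x) = 0 := by
  have hd : ∀ s, 0 ≤ s → HasDerivAt (fun r => ∫ x, (F (φ r x) - F x)) 0 s := fun s hs => by
    -- Time `s` reduces to time 0 by the group law, with `F ∘ φ s`, again Lipschitz, in place of
    -- `F`.
    have h1 : HasDerivAt (fun r => ∫ x, (F (φ s (φ r x)) - F (φ s x))) 0 (s - s) := by
      rw [sub_self]
      exact h.hasDerivAt_integral_comp_sub hK hL hX hc hdiv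
        (hF.comp (h.lipschitzWith_apply hK hs))
    have h2 := (h1.comp_sub_const s s).add_const (∫ x, (F (φ s x) - F x))
    refine h2.congr_of_eventuallyEq (Eventually.of_forall fun r => ?_)
    simp only [← h.add_apply hK]
    have h3 := h.integrable_comp_sub hK hc (hF.continuous.comp (h.continuous_apply hK s)) (r - s)
    rw [← integral_add _ (h.integrable_comp_sub hK hc hF.continuous s)]
    · simp
    · simpa [← h.add_apply hK] using h3
  have := constant_of_has_deriv_right_zero (a := 0) (b := t)
    (HasDerivAt.continuousOn fun s hs => hd s hs.1)
    (fun s hs => (hd s hs.1).hasDerivWithinAt) t ⟨ht, le_rfl⟩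
  simpa [h.zero] using this

end IsGlobalFlow

/-- Two finite Borel measures of the same mass agreeing on Lipschitz functions with values in
`[0, 1]` are equal. -/
theorem measure_eq_of_integral_lipschitz {α : Type*} [PseudoEMetricSpace α] [MeasurableSpace α]
    [BorelSpace α] {μ ν : Measure α} [IsFiniteMeasure μ] [IsFiniteMeasure ν]
    (h : ∀ (f : α → ℝ) (C : ℝ≥0), LipschitzWith C f → (∀ x, f x ∈ Icc 0 1) →
      ∫ x, f x ∂μ = ∫ x, f x ∂ν) : μ = ν := by
  have key : ∀ F : Set α, IsClosed F → μ F = ν F := fun F hF => by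
    -- Thickened indicators are Lipschitz and converge to the indicator of the closed set.
    have hpos : ∀ n : ℕ, 0 < 1 / ((n : ℝ) + 1) := fun n => Nat.one_div_pos_of_nat
    have h1 := tendsto_integral_thickenedIndicator_of_isClosed μ hF hpos
      tendsto_one_div_add_atTop_nhds_zero_nat
    have h2 := tendsto_integral_thickenedIndicator_of_isClosed ν hF hpos
      tendsto_one_div_add_atTop_nhds_zero_nat
    have h3 : ∀ n : ℕ, ∫ x, (thickenedIndicator (hpos n) F x : ℝ) ∂μ =
        ∫ x, (thickenedIndicator (hpos n) F x : ℝ) ∂ν := fun n =>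
      h _ _ (NNReal.isometry_coe.lipschitz.comp (lipschitzWith_thickenedIndicator (hpos n) F)) fun x =>
        ⟨NNReal.coe_nonneg _, by exact_mod_cast thickenedIndicator_le_one (hpos n) F x⟩
    simp_rw [h3] at h1
    exact (measureReal_eq_measureReal_iff).1 (tendsto_nhds_unique h1 h2)
  refine ext_of_generate_finite _ ?_ isPiSystem_isClosed (fun F hF => key F hF) (key _ isClosed_univ)
  rw [BorelSpace.measurable_eq (α := α), borel_eq_generateFrom_isClosed]

/-- **Liouville's theorem**: the flow of a compactly supported divergence free vector field
preserves the Lebesgue measure on the set where the field does not vanish. -/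
theorem IsGlobalFlow.measurePreserving {φ : ℝ → E n → E n} {K L : ℝ≥0} (h : IsGlobalFlow X φ)
    (hK : LipschitzWith K X) (hL : ∀ x, ‖X x‖ ≤ L) (hX : ContDiff ℝ 1 X)
    (hc : HasCompactSupport X) (hdiv : ∀ x, divergence X x = 0) {t : ℝ} (ht : 0 ≤ t) :
    MeasurePreserving (φ t) (volume.restrict (Function.support X))
      (volume.restrict (Function.support X)) := by
  have hcont := h.continuous_apply hK t
  have : IsFiniteMeasure (volume.restrict (Function.support X)) :=
    ⟨by
      rw [Measure.restrict_apply_univ]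
      exact (measure_mono (subset_tsupport X)).trans_lt hc.isCompact.measure_lt_top⟩
  refine ⟨hcont.measurable, measure_eq_of_integral_lipschitz fun f C hf hf01 => ?_⟩
  rw [integral_map hcont.aemeasurable hf.continuous.aestronglyMeasurable, ← sub_eq_zero]
  have hint : ∀ g : E n → ℝ, Continuous g → (∀ x, g x ∈ Icc 0 1) →
      Integrable g (volume.restrict (Function.support X)) := fun g hg hg01 =>
    .of_bound hg.aestronglyMeasurable 1 (Eventually.of_forall fun x => by
      rw [Real.norm_of_nonneg (hg01 x).1]
      exact (hg01 x).2)
  -- Zeros of `X` are fixed, so the integral over the support equals the one over the whole space.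
  rw [← integral_sub (hint (fun x => f (φ t x)) (hf.continuous.comp hcont) fun x => hf01 _)
    (hint _ hf.continuous hf01), setIntegral_eq_integral_of_forall_compl_eq_zero]
  · exact h.integral_comp_sub_eq_zero hK hL hX hc hdiv hf ht
  · intro x hx
    rw [h.apply_of_eq_zero hK (Function.notMem_support.1 hx), sub_self]

/-- Poincaré recurrence for compactly supported divergence free vector fields. -/
theorem isPoincareRecurrentOn_of_divergence_eq_zero (hX : ContDiff ℝ 1 X)
    (hc : HasCompactSupport X) (hdiv : ∀ x, divergence X x = 0) (Ω : Set (E n)) :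
    IsPoincareRecurrentOn X Ω := by
  obtain ⟨K, hK⟩ := hX.lipschitzWith_of_hasCompactSupport hc one_ne_zero
  obtain ⟨B, hB⟩ := hX.continuous.bounded_above_of_compact_support hc
  have hL : ∀ x, ‖X x‖ ≤ B.toNNReal := fun x => (hB x).trans (Real.le_coe_toNNReal B)
  obtain ⟨φ, h⟩ := exists_isGlobalFlow hK hL
  have huniq : ∀ x₀ x, IsTrajectory X x₀ x → x = fun t => φ t x₀ := fun x₀ x hx => by
    rw [← hx.1]
    exact h.eq_of_hasDerivAt hK hx.2
  refine ⟨fun x₀ => ⟨fun t => φ t x₀, ⟨h.zero x₀, h.deriv x₀⟩, huniq x₀⟩, ?_⟩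
  have hmeas : MeasurableSet (Function.support X) :=
    (isOpen_compl_singleton.preimage hX.continuous).measurableSet
  have : IsFiniteMeasure (volume.restrict (Function.support X)) :=
    ⟨by
      rw [Measure.restrict_apply_univ]
      exact (measure_mono (subset_tsupport X)).trans_lt hc.isCompact.measure_lt_top⟩
  -- Returns at integer times suffice, so recurrence is applied to the time-one map.
  have hrec := (h.measurePreserving hK hL hX hc hdiv zero_le_one).conservative
    |>.ae_frequently_mem_of_mem_nhds
  rw [ae_restrict_iff' hmeas] at hrec
  filter_upwards [ae_restrict_of_ae hrec] with x₀ hx₀ x hx ε hε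
  rw [huniq x₀ x hx]
  by_cases h0 : X x₀ = 0
  · refine Eventually.frequently (Eventually.of_forall fun t => ?_)
    simpa [h.apply_of_eq_zero hK h0] using hε
  · have h1 := hx₀ h0 _ (Metric.ball_mem_nhds x₀ hε)
    simp_rw [h.iterate_one hK, Metric.mem_ball] at h1
    exact tendsto_natCast_atTop_atTop.frequently h1

end Liouville

end DiffGame

namespace DiffGame

/-! ### Weak derivatives and orthogonality to ker d₂ -/

section WeakDerivatives

variable {n : ℕ} {f g : E n → ℝ}

theorem contDiff_pderiv (hf : ContDiff ℝ ∞ f) (i : Fin n) : ContDiff ℝ ∞ (pderiv i f) :=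
  (hf.fderiv_right (by simp)).clm_apply contDiff_const

theorem hasCompactSupport_pderiv (hf : HasCompactSupport f) (i : Fin n) :
    HasCompactSupport (pderiv i f) :=
  hf.fderiv_apply ℝ _

theorem pderiv_comm (hf : ContDiff ℝ ∞ f) (i j : Fin n) :
    pderiv i (pderiv j f) = pderiv j (pderiv i f) := by
  have hd : Differentiable ℝ (fderiv ℝ f) :=
    (hf.fderiv_right (m := 1) (WithTop.coe_le_coe.2 le_top)).differentiable one_ne_zero
  have key : ∀ (k l : Fin n) (x : E n), pderiv k (pderiv l f) x =
      fderiv ℝ (fderiv ℝ f) x (EuclideanSpace.single k 1) (EuclideanSpace.single l 1) :=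
    fun k l x => by
      change fderiv ℝ (fun y => fderiv ℝ f y (EuclideanSpace.single l 1)) x _ = _
      rw [fderiv_clm_apply (hd x) (differentiableAt_const _)]
      simp
  ext x
  rw [key, key]
  exact hf.contDiffAt.isSymmSndFDerivAt (by
    rw [minSmoothness_of_isRCLikeNormedField]
    exact WithTop.coe_le_coe.2 (le_top : (2 : ℕ∞) ≤ ⊤)) _ _

theorem integral_mul_pderiv (hf : ContDiff ℝ ∞ f) (hg : ContDiff ℝ ∞ g) (hc : HasCompactSupport g)
    (i : Fin n) : ∫ x, f x * pderiv i g x = -∫ x, pderiv i f x * g x := by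
  refine integral_mul_fderiv_eq_neg_fderiv_mul_of_integrable ?_ ?_ ?_
    (fun x _ => hf.differentiable (by simp) x) fun x _ => hg.differentiable (by simp) x
  · exact ((contDiff_pderiv hf i).continuous.mul hg.continuous).integrable_of_hasCompactSupport
      hc.mul_left
  · exact (hf.continuous.mul (contDiff_pderiv hg i).continuous).integrable_of_hasCompactSupport
      (hasCompactSupport_pderiv hc i).mul_left
  · exact (hf.continuous.mul hg.continuous).integrable_of_hasCompactSupport hc.mul_left

theorem isWeakDeriv_nil (hf : ContDiff ℝ ∞ f) : IsWeakDeriv [] f f :=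
  ⟨hf.continuous.locallyIntegrable, hf.continuous.locallyIntegrable, fun φ _ _ => by
    simp [iterPderiv]⟩

theorem isWeakDeriv_pderiv (hf : ContDiff ℝ ∞ f) (i : Fin n) :
    IsWeakDeriv [i] f (pderiv i f) :=
  ⟨hf.continuous.locallyIntegrable, (contDiff_pderiv hf i).continuous.locallyIntegrable,
    fun φ hφ hc => by simpa [iterPderiv] using integral_mul_pderiv hf hφ hc i⟩

theorem IsWeakDeriv.ae_eq {s : List (Fin n)} {g₁ g₂ : E n → ℝ} (h₁ : IsWeakDeriv s f g₁)
    (h₂ : IsWeakDeriv s f g₂) : g₁ =ᵐ[volume] g₂ := by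
  refine ae_eq_of_integral_contDiff_smul_eq h₁.2.1 h₂.2.1 fun φ hφ hc => ?_
  have h := (h₁.2.2 φ hφ hc).symm.trans (h₂.2.2 φ hφ hc)
  simpa [mul_comm] using mul_left_cancel₀ (pow_ne_zero _ (by norm_num)) h

theorem IsWeakDeriv.weakDeriv_ae_eq {s : List (Fin n)} (h : IsWeakDeriv s f g) :
    weakDeriv s f =ᵐ[volume] g := by
  have hex : ∃ g, IsWeakDeriv s f g := ⟨g, h⟩
  rw [weakDeriv, dif_pos hex]
  exact hex.choose_spec.ae_eq h

theorem memH_one_of_contDiff (hf : ContDiff ℝ ∞ f) (hc : HasCompactSupport f) : MemH 1 f := by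
  intro s hs
  match s, hs with
  | [], _ => exact ⟨f, isWeakDeriv_nil hf, hf.continuous.memLp_of_hasCompactSupport hc⟩
  | [i], _ => exact ⟨pderiv i f, isWeakDeriv_pderiv hf i,
      (contDiff_pderiv hf i).continuous.memLp_of_hasCompactSupport (hasCompactSupport_pderiv hc i)⟩
  | _ :: _ :: _, h => simp at h

/-- The gradient of a function on `ℝⁿ`. -/
noncomputable def grad (f : E n → ℝ) (x : E n) : E n := WithLp.toLp 2 fun i => pderiv i f x

theorem grad_mem_kerD2 (hf : ContDiff ℝ ∞ f) (hc : HasCompactSupport f) : grad f ∈ kerD2 n := by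
  refine ⟨fun i => memH_one_of_contDiff (contDiff_pderiv hf i) (hasCompactSupport_pderiv hc i),
    fun i j => ?_⟩
  have h1 := (isWeakDeriv_pderiv (contDiff_pderiv hf i) j).weakDeriv_ae_eq
  have h2 := (isWeakDeriv_pderiv (contDiff_pderiv hf j) i).weakDeriv_ae_eq
  filter_upwards [h1, h2] with x hx1 hx2
  simp only [d2, grad, Pi.zero_apply]
  split_ifs
  · rw [hx1, hx2, pderiv_comm hf i j]
    simp
  · rfl

theorem pderiv_sum {ι : Type*} (s : Finset ι) {F : ι → E n → ℝ}
    (hF : ∀ i, ContDiff ℝ ∞ (F i)) (j : Fin n) (x : E n) :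
    pderiv j (fun y => ∑ i ∈ s, F i y) x = ∑ i ∈ s, pderiv j (F i) x := by
  simp only [pderiv]
  rw [fderiv_fun_sum fun i _ => (hF i).differentiable (by simp) x]
  simp

variable {X : E n → E n}

theorem contDiff_divergence (hX : ContDiff ℝ ∞ X) : ContDiff ℝ ∞ (divergence X) :=
  ContDiff.sum fun i _ => contDiff_pderiv (contDiff_euclidean.1 hX i) i

theorem hasCompactSupport_divergence (hc : HasCompactSupport X) :
    HasCompactSupport (divergence X) := by
  refine HasCompactSupport.intro hc fun x hx => Finset.sum_eq_zero fun i _ => ?_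
  refine image_eq_zero_of_notMem_tsupport fun h => hx ?_
  exact (closure_mono (Function.support_comp_subset (g := fun v : E n => v i) rfl X))
    (tsupport_fderiv_apply_subset ℝ _ h)

/-- The inner product of `C₁` of a gradient with a smooth field with compact support only depends
on the divergence of the latter. -/
theorem inner1_grad_eq (hX : ContDiff ℝ ∞ X) (hc : HasCompactSupport X) (hf : ContDiff ℝ ∞ f) :
    inner1 (grad f) X =
      -(∫ x, f x * divergence X x) - ∑ j, ∫ x, pderiv j f x * pderiv j (divergence X) x := by
  have hXi : ∀ i, ContDiff ℝ ∞ (fun x => X x i) := contDiff_euclidean.1 hX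
  have hci : ∀ i, HasCompactSupport (fun x => X x i) := hasCompactSupport_coord hc
  have hint : ∀ (f : E n → ℝ), ContDiff ℝ ∞ f → ∀ g : E n → ℝ, ContDiff ℝ ∞ g →
      HasCompactSupport g → Integrable (fun x => f x * g x) := fun f hf g hg hgc =>
    (hf.continuous.mul hg.continuous).integrable_of_hasCompactSupport hgc.mul_left
  have h1 : ∑ i, ∫ x, grad f x i * X x i = -∫ x, f x * divergence X x := by
    simp only [divergence, Finset.mul_sum, grad]
    rw [integral_finsetSum _ fun i _ => hint f hf _ (contDiff_pderiv (hXi i) i)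
      (hasCompactSupport_pderiv (hci i) i), ← Finset.sum_neg_distrib]
    refine Finset.sum_congr rfl fun i _ => ?_
    rw [integral_mul_pderiv hf (hXi i) (hci i), neg_neg]
  -- One integration by parts in direction `i` moves that derivative from `f` to `X i`; summing over
  -- `i` then produces the divergence.
  have h2 : ∀ i j, ∫ x, weakDeriv [j] (fun y => grad f y i) x * weakDeriv [j] (fun y => X y i) x =
      -∫ x, pderiv j f x * pderiv j (pderiv i (fun y => X y i)) x := fun i j => by
    rw [pderiv_comm (hXi i) j i, integral_mul_pderiv (contDiff_pderiv hf j)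
      (contDiff_pderiv (hXi i) j) (hasCompactSupport_pderiv (hci i) j), neg_neg,
      pderiv_comm hf i j]
    refine integral_congr_ae ?_
    filter_upwards [(isWeakDeriv_pderiv (contDiff_pderiv hf i) j).weakDeriv_ae_eq,
      (isWeakDeriv_pderiv (hXi i) j).weakDeriv_ae_eq] with x hx1 hx2
    rw [hx2]
    congr 1
  have h3 : ∀ j, ∫ x, pderiv j f x * pderiv j (divergence X) x =
      ∑ i, ∫ x, pderiv j f x * pderiv j (pderiv i (fun y => X y i)) x := fun j => by
    rw [← integral_finsetSum _ fun i _ => hint _ (contDiff_pderiv hf j) _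
      (contDiff_pderiv (contDiff_pderiv (hXi i) i) j)
      (hasCompactSupport_pderiv (hasCompactSupport_pderiv (hci i) i) j)]
    congr 1 with x
    rw [← Finset.mul_sum, ← pderiv_sum _ fun i => contDiff_pderiv (hXi i) i]
    rfl
  rw [inner1, h1, Finset.sum_comm]
  simp only [h2, h3, Finset.sum_neg_distrib]
  ring

/-- A smooth field with compact support which is orthogonal to the kernel of `d₂` is divergence
free. -/
theorem divergence_eq_zero_of_mem_kerD2Perp (hX : ContDiff ℝ ∞ X) (hc : HasCompactSupport X)
    (hperp : X ∈ kerD2Perp n) (x : E n) : divergence X x = 0 := by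
  have hd := contDiff_divergence hX
  have hdc := hasCompactSupport_divergence hc
  -- The test field is the gradient of the divergence of `X` itself.
  have h0 := hperp.2 _ (grad_mem_kerD2 hd hdc)
  rw [inner1_grad_eq hX hc hd] at h0
  have h1 : 0 ≤ ∑ j, ∫ x, pderiv j (divergence X) x * pderiv j (divergence X) x :=
    Finset.sum_nonneg fun j _ => integral_nonneg fun x => mul_self_nonneg _
  have h2 : 0 ≤ ∫ x, divergence X x * divergence X x :=
    integral_nonneg fun x => mul_self_nonneg _
  have h3 : ∫ x, divergence X x * divergence X x = 0 := by linarith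
  have hcont : Continuous fun x => divergence X x * divergence X x :=
    hd.continuous.mul hd.continuous
  rw [integral_eq_zero_iff_of_nonneg (fun x => mul_self_nonneg _)
    (hcont.integrable_of_hasCompactSupport hdc.mul_left)] at h3
  have h4 := congrFun ((hcont.ae_eq_iff_eq volume continuous_const).1 h3) x
  exact mul_self_eq_zero.1 h4

end WeakDerivatives

/-! ### The simultaneous gradient and the main theorem -/

section SimultaneousGradient

variable {M : ℕ} {d : Fin M → ℕ} {u v w : Fin M → Joint d → ℝ}

theorem contDiff_simGrad (hu : ∀ i, ContDiff ℝ ∞ (u i)) : ContDiff ℝ ∞ (simGrad d u) :=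
  contDiff_euclidean.2 fun _ => contDiff_pderiv (hu _) _

theorem hasCompactSupport_simGrad {Ω : Set (Joint d)} (hΩ : IsCompact Ω)
    (hsupp : ∀ i, tsupport (u i) ⊆ Ω) : HasCompactSupport (simGrad d u) := by
  refine HasCompactSupport.intro hΩ fun x hx => ?_
  ext j
  exact image_eq_zero_of_notMem_tsupport (f := pderiv j (u (owner d j))) fun h =>
    hx (hsupp _ (tsupport_fderiv_apply_subset ℝ _ h))

theorem simGrad_add (hv : ∀ i, ContDiff ℝ ∞ (v i)) (hw : ∀ i, ContDiff ℝ ∞ (w i)) :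
    simGrad d (v + w) = simGrad d v + simGrad d w := by
  ext x j
  simp only [simGrad, pderiv, Pi.add_apply, PiLp.add_apply]
  rw [fderiv_add ((hv _).differentiable (by simp) x) ((hw _).differentiable (by simp) x)]
  rfl

end SimultaneousGradient

end DiffGame

theorem mainTheorem3 {M : ℕ} (d : Fin M → ℕ) (u : Fin M → DiffGame.Joint d → ℝ)
    (hu : DiffGame.IsNearVectorPotential d u)
    (Ω : Set (DiffGame.Joint d)) (hΩ : IsCompact Ω) (hsupp : ∀ i, tsupport (u i) ⊆ Ω) :
    DiffGame.IsPoincareRecurrentOn (DiffGame.simGrad d u) Ω := by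
  obtain ⟨v, hv, w, hw, rfl⟩ := hu
  have hvs : ∀ i, ContDiff ℝ ∞ (v i) := by
    rcases hv with hv | rfl
    · exact fun i => (hv.1 i).2
    · exact fun i => contDiff_const
  have hws : ∀ i, ContDiff ℝ ∞ (w i) := fun i => (hw.1 i).2
  have hc := DiffGame.hasCompactSupport_simGrad hΩ hsupp
  -- Compact support passes to `simGrad d v`, although `v` alone need not have it.
  rw [DiffGame.simGrad_add hvs hws, hw.2, add_zero] at hc ⊢
  have hX := DiffGame.contDiff_simGrad hvs
  refine DiffGame.isPoincareRecurrentOn_of_divergence_eq_zero (hX.of_le (by simp)) hc ?_ Ω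
  rcases hv with hv | rfl
  · exact DiffGame.divergence_eq_zero_of_mem_kerD2Perp hX hc hv.2.2
  · intro x
    simp [DiffGame.divergence, DiffGame.simGrad, DiffGame.pderiv]
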